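/- Let $d\ge 2$, let $e_0,\dots,e_{d-1}\in\mathbb{C}$ be distinct, let $f(w)=(w-e_0)\cdots(w-e_{d-1})$, and let $\eta_j=1/f'(e_j)$. The Poincaré compactification of $\dot w=f(w)$, in real time, is the following flow on the closed disk $\mathbf{D}$. Realize $\mathbf{D}$ as the closed hemisphere $\{(x,s)\in\mathbb{C}\times\mathbb{R}:\ |x|^2+s^2=1,\ s\ge 0\}$, with interior $\mathbb{D}=\{s>0\}$, which is identified with $\mathbb{C}$ by central projection $w=x/s$, and with boundary circle $\mathbb{S}^1=\{s=0\}$. With $F(x,s)=\prod_{j}(x-e_js)$, the flow is generated by $$\dot x=F-\mathrm{Re}(\bar xF)\,x,\qquad \dot s=-\,\mathrm{Re}(\bar xF)\,s .$$ On $\mathbb{D}$ this is $\dot w=s^{d-1}f(w)$, i.e. $\dot w=f(w)$ up to a positive real rescaling of time. The equilibria on $\mathbb{S}^1$ are the $2(d-1)$ points $(e^{-\mathrm{i}\alpha_k},0)$ with $\alpha_k=\pi k/(d-1)$, $0\le k<2(d-1)$; all of them are hyperbolic saddles, called boundary saddles. An interior saddle connection $\gamma:\mathbf{A}\leadsto\mathbf{B}$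 is an orbit of this flow in $\mathbb{D}$ which converges to boundary saddles $\mathbf{A}$, $\mathbf{B}$ as time tends to $-\infty$, $+\infty$, respectively. Let $\gamma:\mathbf{A}\leadsto\mathbf{B}$ be an interior saddle connection, and let $J$ be the set of those indices $j\in\{0,\dots,d-1\}$ for which the interior equilibrium $e_j$ lies on the opposite side of $e_0$, i.e. does not lie in the connected component of $\mathbb{D}\setminus\gamma$ that contains $e_0$. Then $J$ is nonempty, and $$\sum_{j\in J}\mathrm{Re}\,\eta_j=0 .$$ -/

import Mathlib

open scoped Topology

noncomputable section

namespace PoincareCompactification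

variable {d : ℕ}

/-- The monic polynomial `f(w) = (w - e₀) ⋯ (w - e_{d-1})` with zeros `e_j`. -/
def poly (e : Fin d → ℂ) : Polynomial ℂ :=
  ∏ j, (Polynomial.X - Polynomial.C (e j))

/-- The reciprocal linearization `η_j = 1 / f'(e_j)` at the equilibrium `e_j`. -/
def eta (e : Fin d → ℂ) (j : Fin d) : ℂ :=
  1 / (poly e).derivative.eval (e j)

/-- The homogenization `F(x, s) = s ^ d * f(x / s) = (x - e₀ s) ⋯ (x - e_{d-1} s)`. -/
def homog (e : Fin d → ℂ) (p : ℂ × ℝ) : ℂ :=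
  ∏ j, (p.1 - e j * (p.2 : ℂ))

/-- The closed disk of the Poincaré compactification, realized as the closed hemisphere
`|x|² + s² = 1`, `s ≥ 0`. -/
def closedDisk : Set (ℂ × ℝ) := {p | ‖p.1‖ ^ 2 + p.2 ^ 2 = 1 ∧ 0 ≤ p.2}

/-- The interior (open disk): the open hemisphere `s > 0`. -/
def openDisk : Set (ℂ × ℝ) := {p | p ∈ closedDisk ∧ 0 < p.2}

/-- The boundary circle ("circle at infinity"): the equator `s = 0`. -/
def boundaryCircle : Set (ℂ × ℝ) := {p | p ∈ closedDisk ∧ p.2 = 0}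

/-- Central projection of `w ∈ ℂ` (the tangent plane at the pole `(0, 1)`) to the open
hemisphere; its inverse is `(x, s) ↦ x / s`. -/
def toDisk (w : ℂ) : ℂ × ℝ :=
  (w / (Real.sqrt (1 + ‖w‖ ^ 2) : ℂ), 1 / Real.sqrt (1 + ‖w‖ ^ 2))

/-- The vector field of the Poincaré compactification of `ẇ = f(w)`: the component of
`(F, 0)` tangent to the hemisphere,
`ẋ = F - Re(x̄ F) x`, `ṡ = - s Re(x̄ F)`.
On the open disk it is the image of `ẇ = f(w)` under central projection, up to the positive
Euler multiplier `s ^ (d - 1)`, see `velocity_eq`; it is smooth up to the boundary circle,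
which it leaves invariant. -/
def compactField (e : Fin d → ℂ) (p : ℂ × ℝ) : ℂ × ℝ :=
  (homog e p - (((starRingEnd ℂ) p.1 * homog e p).re : ℂ) * p.1,
    -(p.2 * ((starRingEnd ℂ) p.1 * homog e p).re))

/-- The boundary equilibria of the compactified flow. All of them are hyperbolic saddles, and
there are `2 (d - 1)` of them, see `mem_boundarySaddles_iff`. -/
def boundarySaddles (e : Fin d → ℂ) : Set (ℂ × ℝ) :=
  {p | p ∈ boundaryCircle ∧ compactField e p = 0}

/-- `γ` is a (time-parametrized) interior saddle connection from `A` to `B`: a heteroclinic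
orbit of the compactified flow in the open disk between boundary saddles `A` and `B`. -/
structure IsInteriorSaddleConnection (e : Fin d → ℂ) (A B : ℂ × ℝ) (γ : ℝ → ℂ × ℝ) : Prop where
  source_mem : A ∈ boundarySaddles e
  target_mem : B ∈ boundarySaddles e
  mem_openDisk : ∀ t, γ t ∈ openDisk
  orbit : ∀ t, HasDerivAt γ (compactField e (γ t)) t
  tendsto_source : Filter.Tendsto γ Filter.atBot (𝓝 A)
  tendsto_target : Filter.Tendsto γ Filter.atTop (𝓝 B)

open Classical in
/-- The indices `j` of those interior equilibria which do not lie in the same connected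
component of the open disk minus the orbit `γ` as the equilibrium with index `i`. -/
def oppositeSide (e : Fin d → ℂ) (γ : ℝ → ℂ × ℝ) (i : Fin d) : Finset (Fin d) :=
  {j | toDisk (e j) ∉ connectedComponentIn (openDisk \ Set.range γ) (toDisk (e i))}

/-- The compactified field moves `w = x / s` with velocity `s ^ (d - 1) * f(w)`. -/
theorem velocity_eq (e : Fin d → ℂ) (hd : 1 ≤ d) (p : ℂ × ℝ) (hp : 0 < p.2) :
    ((compactField e p).1 * p.2 - p.1 * (compactField e p).2) / (p.2 : ℂ) ^ 2
      = (p.2 : ℂ) ^ (d - 1) * (poly e).eval (p.1 / p.2) := by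
  have hs : (p.2 : ℂ) ≠ 0 := by exact_mod_cast hp.ne'
  have hF : homog e p = (p.2 : ℂ) ^ d * (poly e).eval (p.1 / p.2) := by
    have h1 : ∀ j, p.1 - e j * (p.2 : ℂ) = p.2 * (p.1 / p.2 - e j) := by
      intro j; field_simp
    simp only [homog, poly, Polynomial.eval_prod, Polynomial.eval_sub, Polynomial.eval_X,
      Polynomial.eval_C, h1, Finset.prod_mul_distrib, Finset.prod_const, Finset.card_univ,
      Fintype.card_fin]
  obtain ⟨n, rfl⟩ : ∃ n, d = n + 1 := ⟨d - 1, by omega⟩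
  simp only [compactField, Nat.add_sub_cancel]
  push_cast
  rw [hF]
  field_simp
  ring

/-- The boundary saddles are the points at angles `α_k = π k / (d - 1)`, `0 ≤ k < 2 (d - 1)`,
where `α` is the angle of `z = 1 / w`. -/
theorem mem_boundarySaddles_iff (e : Fin d → ℂ) (hd : 2 ≤ d) (p : ℂ × ℝ) :
    p ∈ boundarySaddles e ↔ ∃ k < 2 * (d - 1),
      p = (Complex.exp (-(Real.pi * k / (d - 1 : ℕ) * Complex.I)), 0) := by
  obtain ⟨n, rfl⟩ : ∃ n, d = n + 1 := ⟨d - 1, by omega⟩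
  have hn : n ≠ 0 := by omega
  have hnC : (n : ℂ) ≠ 0 := by exact_mod_cast hn
  simp only [Nat.add_sub_cancel]
  obtain ⟨x, s⟩ := p
  have key : (x, s) ∈ boundarySaddles e ↔ s = 0 ∧ x⁻¹ ^ (2 * n) = 1 := by
    constructor
    · rintro ⟨⟨⟨h1, -⟩, h2⟩, h3⟩
      simp only at h1 h2
      subst h2
      refine ⟨rfl, ?_⟩
      have hc : (starRingEnd ℂ) x * x = 1 := by
        rw [mul_comm, Complex.mul_conj, Complex.normSq_eq_norm_sq]
        have : ‖x‖ ^ 2 = 1 := by simpa using h1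
        simp [this]
      have hx : x ≠ 0 := by rintro rfl; simp at hc
      have h4 := congrArg Prod.fst h3
      simp only [compactField, homog, Complex.ofReal_zero, mul_zero, sub_zero,
        Finset.prod_const, Finset.card_univ, Fintype.card_fin, Prod.fst_zero] at h4
      have h5 : (starRingEnd ℂ) x * x ^ (n + 1) = x ^ n := by
        rw [pow_succ', ← mul_assoc, hc, one_mul]
      rw [h5, pow_succ, ← sub_mul] at h4
      have h6 : x ^ n = ((x ^ n).re : ℂ) :=
        sub_eq_zero.mp ((mul_eq_zero.mp h4).resolve_right hx)
      have h7 : (starRingEnd ℂ) (x ^ n) * x ^ n = 1 := by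
        rw [map_pow, ← mul_pow, hc, one_pow]
      have h8 : (starRingEnd ℂ) (x ^ n) = x ^ n := by rw [h6, Complex.conj_ofReal]
      rw [h8] at h7
      rw [inv_pow, two_mul, pow_add, h7, inv_one]
    · rintro ⟨rfl, hx⟩
      have hx' : x ^ (2 * n) = 1 := by rw [inv_pow] at hx; simpa using hx
      have hnorm : ‖x‖ = 1 := Complex.norm_eq_one_of_pow_eq_one hx' (by omega)
      have hc : (starRingEnd ℂ) x * x = 1 := by
        rw [mul_comm, Complex.mul_conj, Complex.normSq_eq_norm_sq, hnorm]; simp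
      refine ⟨⟨⟨by simp [hnorm], le_refl _⟩, rfl⟩, ?_⟩
      have h5 : (starRingEnd ℂ) x * x ^ (n + 1) = x ^ n := by
        rw [pow_succ', ← mul_assoc, hc, one_mul]
      have h9 : x ^ n = 1 ∨ x ^ n = -1 := by
        rw [two_mul, pow_add] at hx'; exact mul_self_eq_one_iff.mp hx'
      simp only [compactField, homog, Complex.ofReal_zero, mul_zero, sub_zero,
        Finset.prod_const, Finset.card_univ, Fintype.card_fin, zero_mul, neg_zero, h5]
      rcases h9 with h | h <;> simp [h, pow_succ]
  rw [key]
  have hprim := Complex.isPrimitiveRoot_exp (2 * n) (by omega)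
  have hexp : ∀ k : ℕ, Complex.exp (-(Real.pi * k / n * Complex.I))
      = (Complex.exp (2 * Real.pi * Complex.I / (2 * n : ℕ)) ^ k)⁻¹ := by
    intro k
    rw [← Complex.exp_nat_mul, ← Complex.exp_neg]
    congr 1
    push_cast
    field_simp
  constructor
  · rintro ⟨rfl, hx⟩
    have : NeZero (2 * n) := ⟨by omega⟩
    obtain ⟨k, hk, hk'⟩ := hprim.eq_pow_of_pow_eq_one hx
    exact ⟨k, hk, by rw [hexp, hk', inv_inv]⟩
  · rintro ⟨k, -, h⟩
    rw [Prod.mk.injEq] at h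
    refine ⟨h.2, ?_⟩
    rw [h.1, hexp, inv_inv, ← pow_mul, mul_comm k, pow_mul, hprim.pow_eq_one, one_pow]

end PoincareCompactification

end

/-! In the affine chart `w = x / s` a saddle connection becomes an injective solution of
`ẇ = ρ(t) f(w)`, `ρ > 0`, which tends to infinity in both time directions. Near each of its points
a flow box straightens it to a segment, so its complement has only two local sides, and hence at
most two components.

Lagrange interpolation gives `∑ η_j = 0` and `∑ η_j / (w - e_j) = 1 / f(w)`. Hence
`∑ η_j (1 / (w - e_j) - 1 / (w - e₀)) = 1 / f(w)`, and integrating `dw` along the orbit turns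
the right-hand side into its total time `T = ∫ ρ dt > 0`. As `(w - e_j) / (w - e₀) → 1` at both
ends, the `j`-th integral on the left is `2 π i n_j` with an integer `n_j`, which depends only on
the component of `e_j`: it is `0` on the side of `e₀` and some `n` on the opposite side. Thus
`2 π i n ∑_{j ∈ J} η_j = T` is real and positive, so that `J ≠ ∅`, `n ≠ 0` and `∑_{j ∈ J} η_j` is
imaginary. -/

namespace PoincareCompactification

open Set Filter Bornology Polynomial

section Components

variable {X : Type*} [TopologicalSpace X]

theorem mem_connectedComponentIn_image_iff {Y : Type*} [TopologicalSpace Y] {f : X → Y} {g : Y → X}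
    {s : Set X} (hf : ContinuousOn f s) (hg : ContinuousOn g (f '' s))
    (hgf : Function.LeftInverse g f) {x y : X} :
    f y ∈ connectedComponentIn (f '' s) (f x) ↔ y ∈ connectedComponentIn s x := by
  by_cases hx : x ∈ s
  · refine ⟨fun hy => ?_, fun hy => hf.mapsTo_connectedComponentIn hx hy⟩
    simpa only [hgf.image_image, hgf x, hgf y] using
      hg.mapsTo_connectedComponentIn (mem_image_of_mem f hx) hy
  · rw [connectedComponentIn_eq_empty hx,
      connectedComponentIn_eq_empty fun h => hx (hgf.injective.mem_set_image.1 h)]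
    simp only [mem_empty_iff_false]

theorem mem_connectedComponentIn_of_inter_nonempty {F : Set X} {x y : X} (hy : y ∈ F)
    (h : (connectedComponentIn F x ∩ connectedComponentIn F y).Nonempty) :
    y ∈ connectedComponentIn F x := by
  obtain ⟨z, hzx, hzy⟩ := h
  rw [connectedComponentIn_eq hzx, ← connectedComponentIn_eq hzy]
  exact mem_connectedComponentIn hy

theorem subset_connectedComponentIn_of_inter_nonempty {F S : Set X} {x : X} (hS : IsPreconnected S)
    (hSF : S ⊆ F) (h : (connectedComponentIn F x ∩ S).Nonempty) :
    S ⊆ connectedComponentIn F x := by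
  obtain ⟨y, hyx, hyS⟩ := h
  rw [connectedComponentIn_eq hyx]
  exact hS.subset_connectedComponentIn hyS hSF

theorem closure_connectedComponentIn_compl_inter_nonempty [ConnectedSpace X]
    [LocallyConnectedSpace X] {K : Set X} (hK : IsClosed K) (hne : K.Nonempty) {x : X}
    (hx : x ∉ K) : (closure (connectedComponentIn Kᶜ x) ∩ K).Nonempty := by
  by_contra hdisj
  have hclosed : IsClosed (connectedComponentIn Kᶜ x) := by
    refine isClosed_of_closure_subset fun y hy => ?_
    have hyK : y ∈ Kᶜ := fun hyK => hdisj ⟨y, hy, hyK⟩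
    refine mem_connectedComponentIn_of_inter_nonempty hyK ?_
    rw [inter_comm]
    exact mem_closure_iff.1 hy _ hK.isOpen_compl.connectedComponentIn (mem_connectedComponentIn hyK)
  have huniv : connectedComponentIn Kᶜ x = univ :=
    IsClopen.eq_univ ⟨hclosed, hK.isOpen_compl.connectedComponentIn⟩
      ⟨x, mem_connectedComponentIn hx⟩
  obtain ⟨y, hy⟩ := hne
  exact connectedComponentIn_subset Kᶜ x (huniv ▸ mem_univ y) hy

end Components

section SideSystem

variable {X T ι : Type*} [TopologicalSpace X] [TopologicalSpace T]

/-- `S i t` is, for each `i`, a local side of the curve `w` at time `t`. The sides with the same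
label `i` match up along the curve, and all sides at time `t` together fill a neighborhood of `w t`
up to closure. -/
structure IsSideSystem (w : T → X) (S : ι → T → Set X) : Prop where
  isPreconnected : ∀ i t, IsPreconnected (S i t)
  subset_compl : ∀ i t, S i t ⊆ (range w)ᶜ
  eventually_inter_nonempty : ∀ i t, ∀ᶠ u in 𝓝 t, (S i t ∩ S i u).Nonempty
  closure_mem_nhds : ∀ t, closure (⋃ i, S i t) ∈ 𝓝 (w t)

namespace IsSideSystem

variable {w : T → X} {S : ι → T → Set X}

theorem nonempty (h : IsSideSystem w S) (i : ι) (t : T) : (S i t).Nonempty :=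
  (h.eventually_inter_nonempty i t).self_of_nhds.left

theorem subset_component [PreconnectedSpace T] (h : IsSideSystem w S) {p : X} {i : ι} {t₀ : T}
    (h₀ : S i t₀ ⊆ connectedComponentIn (range w)ᶜ p) (t : T) :
    S i t ⊆ connectedComponentIn (range w)ᶜ p := by
  have transfer : ∀ a b, (S i a ∩ S i b).Nonempty → S i a ⊆ connectedComponentIn (range w)ᶜ p →
      S i b ⊆ connectedComponentIn (range w)ᶜ p := fun a b hab ha =>
    subset_connectedComponentIn_of_inter_nonempty (h.isPreconnected i b) (h.subset_compl i b)
      (hab.mono (inter_subset_inter_left _ ha))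
  refine isPreconnected_univ.induction₂' (fun a b => S i a ⊆ connectedComponentIn (range w)ᶜ p →
    S i b ⊆ connectedComponentIn (range w)ᶜ p) (fun a _ => ?_)
    (fun a b c _ _ _ hab hbc => hbc ∘ hab) (mem_univ t₀) (mem_univ t) h₀
  rw [nhdsWithin_univ]
  filter_upwards [h.eventually_inter_nonempty i a] with b hab
  exact ⟨transfer a b hab, transfer b a (inter_comm (S i a) _ ▸ hab)⟩

theorem exists_subset_component [ConnectedSpace X] [LocallyConnectedSpace X] [ConnectedSpace T]
    (h : IsSideSystem w S) (hw : IsClosed (range w)) {p : X} (hp : p ∉ range w) :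
    ∃ i, ∀ t, S i t ⊆ connectedComponentIn (range w)ᶜ p := by
  obtain ⟨_, hcl, t, rfl⟩ :=
    closure_connectedComponentIn_compl_inter_nonempty hw (range_nonempty w) hp
  obtain ⟨y, hyS, hyp⟩ := mem_closure_iff_nhds.1 hcl _ (h.closure_mem_nhds t)
  obtain ⟨z, hzp, hzS⟩ := mem_closure_iff.1 hyS _ hw.isOpen_compl.connectedComponentIn hyp
  obtain ⟨i, hzi⟩ := mem_iUnion.1 hzS
  exact ⟨i, h.subset_component (subset_connectedComponentIn_of_inter_nonempty
    (h.isPreconnected i t) (h.subset_compl i t) ⟨z, hzp, hzi⟩)⟩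

theorem mem_component_of_notMem_component [ConnectedSpace X] [LocallyConnectedSpace X]
    [ConnectedSpace T] {S : ℤˣ → T → Set X} (h : IsSideSystem w S) (hw : IsClosed (range w))
    {o p q : X} (ho : o ∉ range w) (hp : p ∉ range w) (hq : q ∉ range w)
    (hpo : p ∉ connectedComponentIn (range w)ᶜ o) (hqo : q ∉ connectedComponentIn (range w)ᶜ o) :
    q ∈ connectedComponentIn (range w)ᶜ p := by
  obtain ⟨t⟩ : Nonempty T := inferInstance
  have mem_of_common_side : ∀ {x y : X} {i : ℤˣ}, y ∉ range w →
      (∀ t, S i t ⊆ connectedComponentIn (range w)ᶜ x) →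
      (∀ t, S i t ⊆ connectedComponentIn (range w)ᶜ y) →
      y ∈ connectedComponentIn (range w)ᶜ x := fun {x y i} hy hx' hy' =>
    mem_connectedComponentIn_of_inter_nonempty hy
      ((h.nonempty i t).mono (subset_inter (hx' t) (hy' t)))
  obtain ⟨i, hi⟩ := h.exists_subset_component hw ho
  obtain ⟨j, hj⟩ := h.exists_subset_component hw hp
  obtain ⟨k, hk⟩ := h.exists_subset_component hw hq
  have hji : j ≠ i := fun hji => hpo (mem_of_common_side hp hi (hji ▸ hj))
  have hki : k ≠ i := fun hki => hqo (mem_of_common_side hq hi (hki ▸ hk))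
  have hkj : k = j := by
    rw [Int.units_ne_iff_eq_neg.1 hji, Int.units_ne_iff_eq_neg.1 hki]
  exact mem_of_common_side hq hj (hkj ▸ hk)

end IsSideSystem

end SideSystem

section ProperTrajectory

/-- A `C¹` curve in the plane which tends to infinity in both time directions. -/
structure IsProperCurve (w : ℝ → ℂ) : Prop where
  contDiff : ContDiff ℝ 1 w
  tendsto_atBot : Tendsto w atBot (cobounded ℂ)
  tendsto_atTop : Tendsto w atTop (cobounded ℂ)

/-- An injective and nonconstant solution of `ẇ = ρ(t) f(w)`, i.e. of `ẇ = f(w)` up to a positive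
rescaling `ρ` of time, which tends to infinity in both time directions. -/
structure IsProperTrajectory (f : ℂ → ℂ) (ρ : ℝ → ℝ) (w : ℝ → ℂ) : Prop extends
    IsProperCurve w where
  rate_pos : ∀ t, 0 < ρ t
  hasDerivAt : ∀ t, HasDerivAt w (ρ t * f (w t)) t
  ne_zero : ∀ t, f (w t) ≠ 0
  injective : Function.Injective w

namespace IsProperCurve

variable {w : ℝ → ℂ}

theorem isClosedMap (h : IsProperCurve w) : IsClosedMap w := by
  refine (isProperMap_iff_tendsto_cocompact.2 ⟨h.contDiff.continuous, ?_⟩).isClosedMap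
  rw [cocompact_eq_atBot_atTop, ← Metric.cobounded_eq_cocompact]
  exact h.tendsto_atBot.sup h.tendsto_atTop

theorem isClosed_range (h : IsProperCurve w) : IsClosed (range w) :=
  h.isClosedMap.isClosed_range

end IsProperCurve

end ProperTrajectory

section FlowBox

theorem exists_openPartialHomeomorph_hasDerivAt {g : ℂ → ℂ} {a : ℂ}
    (hg : ∀ᶠ y in 𝓝 a, DifferentiableAt ℂ g y) (ha : g a ≠ 0) :
    ∃ φ : OpenPartialHomeomorph ℂ ℂ, a ∈ φ.source ∧ φ a = 0 ∧
      ∀ y ∈ φ.source, HasDerivAt φ (g y) y := by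
  obtain ⟨r, hr, hball⟩ := Metric.eventually_nhds_iff_ball.1 hg
  have hdiff : DifferentiableOn ℂ g (Metric.ball a r) :=
    fun y hy => (hball y hy).differentiableWithinAt
  obtain ⟨G, hG⟩ := hdiff.isExactOn_ball
  have hmem : a ∈ Metric.ball a r := Metric.mem_ball_self hr
  let Φ : ℂ → ℂ := fun y => G y - G a
  have hΦ : ∀ y ∈ Metric.ball a r, HasDerivAt Φ (g y) y := fun y hy => (hG y hy).sub_const _
  have hstrict : HasStrictDerivAt Φ (g a) a := by
    have hanalytic : AnalyticAt ℂ Φ a := DifferentiableOn.analyticAt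
      (fun y hy => (hΦ y hy).differentiableAt.differentiableWithinAt)
      (Metric.isOpen_ball.mem_nhds hmem)
    exact (hΦ a hmem).deriv ▸ hanalytic.hasStrictDerivAt
  have hequiv := hstrict.hasStrictFDerivAt_equiv ha
  exact ⟨(hequiv.toOpenPartialHomeomorph Φ).restrOpen _ Metric.isOpen_ball,
    ⟨hequiv.mem_toOpenPartialHomeomorph_source, hmem⟩, sub_self _, fun y hy => hΦ y hy.2⟩

/-- `φ` is a chart of complex time `∫ dw / f(w)`, which straightens the trajectories of `ẇ = f(w)`
into horizontal lines, and all visits of `w` to its domain lie on the real axis of the chart. -/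
structure IsFlowBox (f : ℂ → ℂ) (w : ℝ → ℂ) (φ : OpenPartialHomeomorph ℂ ℂ) : Prop where
  hasDerivAt : ∀ y ∈ φ.source, HasDerivAt φ (f y)⁻¹ y
  convex_target : Convex ℝ φ.target
  im_eq_zero : ∀ t, w t ∈ φ.source → (φ (w t)).im = 0

/-- The upper (`0 < σ`) or lower (`σ < 0`) half of the domain of the chart `φ`. -/
def chartSide (φ : OpenPartialHomeomorph ℂ ℂ) (σ : ℝ) : Set ℂ :=
  {y | y ∈ φ.source ∧ 0 < σ * (φ y).im}

theorem isPreconnected_chartSide {φ : OpenPartialHomeomorph ℂ ℂ} (hφ : Convex ℝ φ.target) (σ : ℝ) :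
    IsPreconnected (chartSide φ σ) := by
  have himage : chartSide φ σ = φ.symm '' (φ.target ∩ {z | 0 < σ * z.im}) := by
    rw [φ.symm_image_eq_source_inter_preimage inter_subset_left]
    ext y
    exact and_congr_right fun hy => (and_iff_right (φ.map_source hy)).symm
  have hconvex : Convex ℝ {z : ℂ | 0 < σ * z.im} :=
    convex_halfSpace_gt (σ • Complex.imLm).isLinear 0
  rw [himage]
  exact (hφ.inter hconvex).isPreconnected.image _ (φ.continuousOn_symm.mono inter_subset_left)

theorem source_subset_closure_chartSide (φ : OpenPartialHomeomorph ℂ ℂ) :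
    φ.source ⊆ closure (⋃ σ : ℤˣ, chartSide φ (σ : ℤ)) := by
  intro y hy
  have hdense : Dense {z : ℂ | z.im ≠ 0} :=
    (dense_compl_singleton (0 : ℝ)).preimage Complex.isOpenMap_im
  have hfreq : ∃ᶠ z in 𝓝 (φ y), z.im ≠ 0 ∧ z ∈ φ.target :=
    (mem_closure_iff_frequently.1 (hdense (φ y))).and_eventually
      (φ.open_target.mem_nhds (φ.map_source hy))
  have htendsto : Tendsto φ.symm (𝓝 (φ y)) (𝓝 y) := by
    simpa only [φ.left_inv hy] using (φ.continuousAt_symm (φ.map_source hy)).tendsto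
  refine mem_closure_iff_frequently.2 (htendsto.frequently (hfreq.mono ?_))
  rintro z ⟨him, hz⟩
  rcases him.lt_or_gt with hneg | hpos
  · exact mem_iUnion.2 ⟨-1, φ.map_target hz, by simpa [φ.right_inv hz] using hneg⟩
  · exact mem_iUnion.2 ⟨1, φ.map_target hz, by simpa [φ.right_inv hz] using hpos⟩

namespace IsFlowBox

variable {f : ℂ → ℂ} {w : ℝ → ℂ} {φ : OpenPartialHomeomorph ℂ ℂ}

theorem chartSide_subset_compl (h : IsFlowBox f w φ) (σ : ℝ) : chartSide φ σ ⊆ (range w)ᶜ := by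
  rintro _ ⟨hsource, hpos⟩ ⟨t, rfl⟩
  simp [h.im_eq_zero t hsource] at hpos

theorem eventually_normal_mem_chartSide (h : IsFlowBox f w φ) {σ : ℝ} (hσ : σ ≠ 0) {t : ℝ}
    (ht : w t ∈ φ.source) (hf : f (w t) ≠ 0) :
    ∀ᶠ ε : ℝ in 𝓝[>] 0, w t + ε * (σ * Complex.I * f (w t)) ∈ chartSide φ σ := by
  set n : ℝ → ℂ := fun ε => w t + ε * (σ * Complex.I * f (w t)) with hn
  have hn0 : n 0 = w t := by simp [hn]
  have hnderiv : HasDerivAt n (σ * Complex.I * f (w t)) 0 := by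
    simpa [hn] using ((Complex.ofRealCLM.hasDerivAt (x := (0 : ℝ))).mul_const
      (σ * Complex.I * f (w t))).const_add (w t)
  have hsource : ∀ᶠ ε in 𝓝 0, n ε ∈ φ.source :=
    hnderiv.continuousAt.preimage_mem_nhds (φ.open_source.mem_nhds (hn0 ▸ ht))
  have hφn : HasDerivAt (fun ε => φ (n ε)) (σ * Complex.I) 0 := by
    refine (HasDerivAt.scomp_of_eq (0 : ℝ) (h.hasDerivAt _ ht) hnderiv hn0.symm).congr_deriv ?_
    rw [smul_eq_mul, mul_assoc, mul_inv_cancel₀ hf, mul_one]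
  have hheight : HasDerivAt (fun ε => σ * (φ (n ε)).im) (σ * σ) 0 := by
    simpa using (Complex.imCLM.hasFDerivAt.comp_hasDerivAt (0 : ℝ) hφn).const_mul σ
  have hslope := hheight.tendsto_slope.mono_left
    (nhdsWithin_mono (0 : ℝ) fun x (hx : 0 < x) => hx.ne')
  filter_upwards [hslope.eventually (lt_mem_nhds (mul_self_pos.2 hσ)), self_mem_nhdsWithin,
    nhdsWithin_le_nhds hsource] with ε hε hε0 hεs
  rw [slope_def_field, hn0, h.im_eq_zero t ht, mul_zero, sub_zero, sub_zero] at hε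
  exact ⟨hεs, (div_pos_iff_of_pos_right hε0).1 hε⟩

end IsFlowBox

namespace IsProperTrajectory

variable {f : ℂ → ℂ} {ρ : ℝ → ℝ} {w : ℝ → ℂ}

theorem im_chart_eq (h : IsProperTrajectory f ρ w) {φ : OpenPartialHomeomorph ℂ ℂ}
    (hφ : ∀ y ∈ φ.source, HasDerivAt φ (f y)⁻¹ y) {s : Set ℝ} (hs : IsOpen s)
    (hs' : IsPreconnected s) (hsw : MapsTo w s φ.source) {t u : ℝ} (ht : t ∈ s) (hu : u ∈ s) :
    (φ (w t)).im = (φ (w u)).im := by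
  have hderiv : ∀ t ∈ s, HasDerivAt (fun t => (φ (w t)).im) 0 t := by
    intro t ht
    have hφw : HasDerivAt (φ ∘ w) (ρ t) t := by
      refine ((hφ (w t) (hsw ht)).scomp t (h.hasDerivAt t)).congr_deriv ?_
      rw [smul_eq_mul, mul_assoc, mul_inv_cancel₀ (h.ne_zero t), mul_one]
    simpa [Function.comp_def] using Complex.imCLM.hasFDerivAt.comp_hasDerivAt t hφw
  exact hs.is_const_of_deriv_eq_zero hs'
    (fun t ht => (hderiv t ht).differentiableAt.differentiableWithinAt)
    (fun t ht => (hderiv t ht).deriv) ht hu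

theorem exists_isFlowBox (h : IsProperTrajectory f ρ w) (hf : Differentiable ℂ f) (t₀ : ℝ) :
    ∃ φ, IsFlowBox f w φ ∧ w t₀ ∈ φ.source := by
  obtain ⟨φ, hφ₀, hφ0, hφ⟩ := exists_openPartialHomeomorph_hasDerivAt
    (g := fun y => (f y)⁻¹) ((hf.continuous.continuousAt.eventually_ne (h.ne_zero t₀)).mono
      fun y hy => (hf y).inv hy) (inv_ne_zero (h.ne_zero t₀))
  obtain ⟨δ, hδ, hδφ⟩ := Metric.mem_nhds_iff.1 (h.contDiff.continuous.continuousAt.preimage_mem_nhds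
    (φ.open_source.mem_nhds hφ₀))
  have hfar : (w '' (Metric.ball t₀ δ)ᶜ)ᶜ ∈ 𝓝 (w t₀) := by
    refine (h.isClosedMap _ Metric.isOpen_ball.isClosed_compl).isOpen_compl.mem_nhds ?_
    rw [mem_compl_iff, h.injective.mem_set_image, notMem_compl_iff]
    exact Metric.mem_ball_self hδ
  have hzero : (0 : ℂ) ∈ φ.target := hφ0 ▸ φ.map_source hφ₀
  have hsymm : φ.symm 0 = w t₀ := hφ0 ▸ φ.left_inv hφ₀
  obtain ⟨r, hr, hball⟩ := Metric.mem_nhds_iff.1 (inter_mem (φ.open_target.mem_nhds hzero)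
    ((φ.continuousAt_symm hzero).preimage_mem_nhds (hsymm ▸ hfar)))
  have hball' : φ.target ∩ Metric.ball 0 r = Metric.ball 0 r :=
    inter_eq_right.2 fun z hz => (hball hz).1
  refine ⟨(φ.symm.restrOpen (Metric.ball 0 r) Metric.isOpen_ball).symm,
    ⟨fun y hy => hφ y hy.1, ?_, ?_⟩, hφ₀, ?_⟩
  · exact (hball'.symm ▸ convex_ball 0 r : Convex ℝ (φ.target ∩ Metric.ball 0 r))
  · rintro t ⟨ht, htr⟩
    have htδ : t ∈ Metric.ball t₀ δ := by
      by_contra htδ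
      exact (hball htr).2 ⟨t, htδ, (φ.left_inv ht).symm⟩
    rw [← Complex.zero_im, ← hφ0]
    exact h.im_chart_eq hφ Metric.isOpen_ball (convex_ball t₀ δ).isPreconnected hδφ htδ
      (Metric.mem_ball_self hδ)
  · simpa [hφ0] using hr

theorem exists_isSideSystem (h : IsProperTrajectory f ρ w) (hf : Differentiable ℂ f) :
    ∃ S : ℤˣ → ℝ → Set ℂ, IsSideSystem w S := by
  choose φ hφ hmem using h.exists_isFlowBox hf
  refine ⟨fun σ t => chartSide (φ t) (σ : ℤ),
    fun σ t => isPreconnected_chartSide (hφ t).convex_target _,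
    fun σ t => (hφ t).chartSide_subset_compl _, fun σ t => ?_, fun t =>
    mem_of_superset ((φ t).open_source.mem_nhds (hmem t)) (source_subset_closure_chartSide (φ t))⟩
  have hσ : ((σ : ℤ) : ℝ) ≠ 0 := Int.cast_ne_zero.2 σ.ne_zero
  filter_upwards [h.contDiff.continuous.continuousAt.preimage_mem_nhds
    ((φ t).open_source.mem_nhds (hmem t))] with u hu
  obtain ⟨ε, hεt, hεu⟩ := (((hφ t).eventually_normal_mem_chartSide hσ hu (h.ne_zero u)).and
    ((hφ u).eventually_normal_mem_chartSide hσ (hmem u) (h.ne_zero u))).exists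
  exact ⟨_, hεt, hεu⟩

theorem mem_component_of_notMem_component (h : IsProperTrajectory f ρ w)
    (hf : Differentiable ℂ f) {o p q : ℂ} (ho : o ∉ range w) (hp : p ∉ range w)
    (hq : q ∉ range w) (hpo : p ∉ connectedComponentIn (range w)ᶜ o)
    (hqo : q ∉ connectedComponentIn (range w)ᶜ o) : q ∈ connectedComponentIn (range w)ᶜ p :=
  let ⟨_, hS⟩ := h.exists_isSideSystem hf
  hS.mem_component_of_notMem_component h.isClosed_range ho hp hq hpo hqo

end IsProperTrajectory

end FlowBox

section ImproperIntegral

variable {E F : Type*} [NormedAddCommGroup E] [NormedSpace ℝ E] [NormedAddCommGroup F]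
  [NormedSpace ℝ F]

/-- The improper integral of `g` over the real line exists and equals `z`, expressed through a
primitive of `g` normalized by its limit `0` at `-∞`. The convergence may be conditional. -/
def HasImproperIntegral (g : ℝ → E) (z : E) : Prop :=
  ∃ G : ℝ → E, (∀ t, HasDerivAt G (g t) t) ∧ Tendsto G atBot (𝓝 0) ∧ Tendsto G atTop (𝓝 z)

namespace HasImproperIntegral

variable {g g₁ g₂ : ℝ → E} {z z₁ z₂ : E}

theorem of_hasDerivAt {G : ℝ → E} {a b : E} (hG : ∀ t, HasDerivAt G (g t) t)
    (ha : Tendsto G atBot (𝓝 a)) (hb : Tendsto G atTop (𝓝 b)) : HasImproperIntegral g (b - a) :=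
  ⟨fun t => G t - a, fun t => (hG t).sub_const a, sub_self a ▸ ha.sub_const a, hb.sub_const a⟩

theorem clm_apply (h : HasImproperIntegral g z) (L : E →L[ℝ] F) :
    HasImproperIntegral (fun t => L (g t)) (L z) := by
  obtain ⟨G, hG, hbot, htop⟩ := h
  exact ⟨fun t => L (G t), fun t => L.hasFDerivAt.comp_hasDerivAt t (hG t),
    L.map_zero ▸ (L.continuous.tendsto 0).comp hbot, (L.continuous.tendsto z).comp htop⟩

theorem neg (h : HasImproperIntegral g z) : HasImproperIntegral (fun t => -g t) (-z) :=
  h.clm_apply (-ContinuousLinearMap.id ℝ E)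

theorem const_mul {g : ℝ → ℂ} {z : ℂ} (h : HasImproperIntegral g z) (c : ℂ) :
    HasImproperIntegral (fun t => c * g t) (c * z) :=
  h.clm_apply (ContinuousLinearMap.mul ℝ ℂ c)

theorem add (h₁ : HasImproperIntegral g₁ z₁) (h₂ : HasImproperIntegral g₂ z₂) :
    HasImproperIntegral (fun t => g₁ t + g₂ t) (z₁ + z₂) := by
  obtain ⟨G₁, hG₁, hbot₁, htop₁⟩ := h₁
  obtain ⟨G₂, hG₂, hbot₂, htop₂⟩ := h₂
  exact ⟨fun t => G₁ t + G₂ t, fun t => (hG₁ t).add (hG₂ t), add_zero (0 : E) ▸ hbot₁.add hbot₂,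
    htop₁.add htop₂⟩

theorem sum {ι : Type*} {s : Finset ι} {g : ι → ℝ → E} {z : ι → E}
    (h : ∀ i ∈ s, HasImproperIntegral (g i) (z i)) :
    HasImproperIntegral (fun t => ∑ i ∈ s, g i t) (∑ i ∈ s, z i) := by
  choose! G hG hbot htop using h
  exact ⟨fun t => ∑ i ∈ s, G i t, fun t => HasDerivAt.fun_sum fun i hi => hG i hi t,
    Finset.sum_const_zero (s := s) (M := E) ▸ tendsto_finsetSum s hbot, tendsto_finsetSum s htop⟩

theorem unique (h₁ : HasImproperIntegral g z₁) (h₂ : HasImproperIntegral g z₂) : z₁ = z₂ := by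
  obtain ⟨G₁, hG₁, hbot₁, htop₁⟩ := h₁
  obtain ⟨G₂, hG₂, hbot₂, htop₂⟩ := h₂
  obtain ⟨a, ha⟩ := isOpen_univ.exists_eq_add_of_deriv_eq isPreconnected_univ
    (fun t _ => (hG₁ t).differentiableAt.differentiableWithinAt)
    (fun t _ => (hG₂ t).differentiableAt.differentiableWithinAt)
    (fun t _ => (hG₁ t).deriv.trans (hG₂ t).deriv.symm)
  have hG : G₁ = fun t => G₂ t + a := funext fun t => ha (mem_univ t)
  have ha0 : (0 : E) = 0 + a := tendsto_nhds_unique hbot₁ (hG ▸ hbot₂.add_const a)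
  rw [zero_add] at ha0
  refine tendsto_nhds_unique htop₁ ?_
  simpa only [hG, ← ha0, add_zero] using htop₂

theorem zero : HasImproperIntegral (fun _ => (0 : E)) 0 :=
  ⟨fun _ => 0, fun t => hasDerivAt_const t 0, tendsto_const_nhds, tendsto_const_nhds⟩

theorem pos {ρ : ℝ → ℝ} {T : ℝ} (h : HasImproperIntegral ρ T) (hρ : ∀ t, 0 < ρ t) : 0 < T := by
  obtain ⟨G, hG, hbot, htop⟩ := h
  have hmono : StrictMono G := strictMono_of_hasDerivAt_pos hG hρ
  calc 0 ≤ G 0 := hmono.monotone.le_of_tendsto hbot 0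
    _ < G 1 := hmono one_pos
    _ ≤ T := hmono.monotone.ge_of_tendsto htop 1

theorem exists_pos_of_ofReal {ρ : ℝ → ℝ} {z : ℂ} (h : HasImproperIntegral (fun t => (ρ t : ℂ)) z)
    (hρ : ∀ t, 0 < ρ t) : ∃ T : ℝ, 0 < T ∧ z = T := by
  have hre : HasImproperIntegral ρ z.re := h.clm_apply Complex.reCLM
  have him : HasImproperIntegral (fun _ => (0 : ℝ)) z.im := h.clm_apply Complex.imCLM
  exact ⟨z.re, hre.pos hρ, Complex.ext rfl (him.unique zero)⟩

end HasImproperIntegral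

end ImproperIntegral

section LogDeriv

variable {h L : ℝ → ℂ} {a b : ℂ}

theorem exists_tendsto_of_hasDerivAt_logDeriv (hh : Differentiable ℝ h)
    (hL : ∀ t, HasDerivAt L (logDeriv h t) t) {l : Filter ℝ} {s : Set ℝ} (hs : IsOpen s)
    (hs' : IsPreconnected s) (hsl : s ∈ l) (hslit : ∀ t ∈ s, h t ∈ Complex.slitPlane)
    (ha : a ∈ Complex.slitPlane) (hlim : Tendsto h l (𝓝 a)) : ∃ c, Tendsto L l (𝓝 c) := by
  have hlog : ∀ t ∈ s, HasDerivAt (fun t => Complex.log (h t)) (logDeriv h t) t := fun t ht =>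
    (hh t).hasDerivAt.clog_real (hslit t ht)
  obtain ⟨c, hc⟩ := hs.exists_eq_add_of_deriv_eq hs'
    (fun t _ => (hL t).differentiableAt.differentiableWithinAt)
    (fun t ht => (hlog t ht).differentiableAt.differentiableWithinAt)
    (fun t ht => (hL t).deriv.trans (hlog t ht).deriv.symm)
  have hlim' := ((continuousAt_clog ha).tendsto.comp hlim).add_const c
  exact ⟨_, hlim'.congr' (mem_of_superset hsl hc.symm)⟩

theorem exists_cexp_eq_const_mul_of_hasDerivAt_logDeriv (hh : Differentiable ℝ h)
    (hne : ∀ t, h t ≠ 0) (hL : ∀ t, HasDerivAt L (logDeriv h t) t) :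
    ∃ c ≠ 0, ∀ t, Complex.exp (L t) = c * h t := by
  have hexp : ∀ t, HasDerivAt (fun t => Complex.exp (L t)) (Complex.exp (L t) * logDeriv h t) t :=
    fun t => (hL t).cexp
  have hlogDeriv : EqOn (logDeriv fun t => Complex.exp (L t)) (logDeriv h) univ := fun t _ => by
    rw [logDeriv_apply, (hexp t).deriv, mul_div_cancel_left₀ _ (Complex.exp_ne_zero _)]
  obtain ⟨c, hc, heq⟩ := (logDeriv_eqOn_iff
    (fun t _ => (hexp t).differentiableAt.differentiableWithinAt) hh.differentiableOn isOpen_univ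
    isPreconnected_univ (fun t _ => hne t) fun _ _ => Complex.exp_ne_zero _).1 hlogDeriv
  exact ⟨c, hc, fun t => heq (mem_univ t)⟩

theorem exists_hasImproperIntegral_logDeriv (hh : ContDiff ℝ 1 h) (hne : ∀ t, h t ≠ 0)
    (ha : a ∈ Complex.slitPlane) (hb : b ∈ Complex.slitPlane) (hbot : Tendsto h atBot (𝓝 a))
    (htop : Tendsto h atTop (𝓝 b)) :
    ∃ z, HasImproperIntegral (logDeriv h) z ∧ Complex.exp z = b / a := by
  have hdiff : Differentiable ℝ h := hh.differentiable one_ne_zero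
  have hcont : Continuous (logDeriv h) := (hh.continuous_deriv le_rfl).div₀ hh.continuous hne
  have hL : ∀ t, HasDerivAt (fun u => ∫ s in (0 : ℝ)..u, logDeriv h s) (logDeriv h t) t :=
    fun t => (hcont.integral_hasStrictDerivAt 0 t).hasDerivAt
  obtain ⟨m, hm⟩ := eventually_atBot.1 (hbot.eventually (Complex.isOpen_slitPlane.mem_nhds ha))
  obtain ⟨M, hM⟩ := eventually_atTop.1 (htop.eventually (Complex.isOpen_slitPlane.mem_nhds hb))
  obtain ⟨x, hx⟩ := exists_tendsto_of_hasDerivAt_logDeriv hdiff hL isOpen_Iio isPreconnected_Iio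
    (Iio_mem_atBot m) (fun t ht => hm t (mem_Iio.1 ht).le) ha hbot
  obtain ⟨y, hy⟩ := exists_tendsto_of_hasDerivAt_logDeriv hdiff hL isOpen_Ioi isPreconnected_Ioi
    (Ioi_mem_atTop M) (fun t ht => hM t (mem_Ioi.1 ht).le) hb htop
  obtain ⟨c, hc, hexp⟩ := exists_cexp_eq_const_mul_of_hasDerivAt_logDeriv hdiff hne hL
  have hexp_lim : ∀ {l : Filter ℝ} [l.NeBot] {x a : ℂ}, Tendsto h l (𝓝 a) →
      Tendsto (fun u => ∫ s in (0 : ℝ)..u, logDeriv h s) l (𝓝 x) → Complex.exp x = c * a :=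
    fun ha hx => tendsto_nhds_unique ((Complex.continuous_exp.tendsto _).comp hx)
      ((ha.const_mul c).congr fun t => (hexp t).symm)
  refine ⟨y - x, .of_hasDerivAt hL hx hy, ?_⟩
  rw [Complex.exp_sub, hexp_lim htop hy, hexp_lim hbot hx, mul_div_mul_left _ _ hc]

theorem hasImproperIntegral_logDeriv_of_mem_slitPlane (hh : Differentiable ℝ h)
    (hslit : ∀ t, h t ∈ Complex.slitPlane) (ha : a ∈ Complex.slitPlane)
    (hb : b ∈ Complex.slitPlane) (hbot : Tendsto h atBot (𝓝 a)) (htop : Tendsto h atTop (𝓝 b)) :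
    HasImproperIntegral (logDeriv h) (Complex.log b - Complex.log a) :=
  .of_hasDerivAt (fun t => (hh t).hasDerivAt.clog_real (hslit t))
    ((continuousAt_clog ha).tendsto.comp hbot) ((continuousAt_clog hb).tendsto.comp htop)

end LogDeriv

section Winding

/-- The integrand `w' / (w - p) - w' / (w - q)`, whose integral is `2πi` times the winding number
of the curve `w` around `p` relative to `q`. Only this difference makes sense for a curve from `∞`
to `∞`. -/
noncomputable def windingKernel (w : ℝ → ℂ) (p q : ℂ) (t : ℝ) : ℂ :=
  deriv w t * ((w t - p)⁻¹ - (w t - q)⁻¹)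

theorem windingKernel_add_windingKernel (w : ℝ → ℂ) (p q r : ℂ) (t : ℝ) :
    windingKernel w p q t + windingKernel w q r t = windingKernel w p r t := by
  simp only [windingKernel]
  ring

theorem neg_windingKernel (w : ℝ → ℂ) (p q : ℂ) (t : ℝ) :
    -windingKernel w p q t = windingKernel w q p t := by
  simp only [windingKernel]
  ring

theorem tendsto_sub_div_sub_cobounded {𝕜 : Type*} [NormedField 𝕜] (p q : 𝕜) :
    Tendsto (fun x => (x - p) / (x - q)) (cobounded 𝕜) (𝓝 1) := by
  have hinv : Tendsto (fun x => (x - q)⁻¹) (cobounded 𝕜) (𝓝 0) :=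
    tendsto_inv₀_cobounded.comp (tendsto_sub_const_cobounded q)
  have hlim : Tendsto (fun x => 1 + (q - p) * (x - q)⁻¹) (cobounded 𝕜) (𝓝 1) := by
    simpa using (hinv.const_mul (q - p)).const_add 1
  refine hlim.congr' ?_
  filter_upwards [eventually_ne_cobounded q] with x hx
  have hxq : x - q ≠ 0 := sub_ne_zero.2 hx
  field_simp
  ring

namespace IsProperCurve

variable {w : ℝ → ℂ} {p q : ℂ}

theorem windingKernel_eq_logDeriv (h : IsProperCurve w) (hp : p ∉ range w) (hq : q ∉ range w) :
    windingKernel w p q = logDeriv fun t => (w t - p) / (w t - q) := by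
  funext t
  have hw : DifferentiableAt ℝ w t := (h.contDiff.differentiable one_ne_zero).differentiableAt
  rw [logDeriv_div (f := fun t => w t - p) (g := fun t => w t - q) t
    (sub_ne_zero.2 fun ht => hp ⟨t, ht⟩) (sub_ne_zero.2 fun ht => hq ⟨t, ht⟩) (hw.sub_const p)
    (hw.sub_const q)]
  simp only [windingKernel, logDeriv_apply, deriv_sub_const]
  ring

theorem contDiff_sub_div_sub (h : IsProperCurve w) (hq : q ∉ range w) :
    ContDiff ℝ 1 fun t => (w t - p) / (w t - q) := by
  simp only [div_eq_mul_inv]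
  exact (h.contDiff.sub contDiff_const).mul
    ((h.contDiff.sub contDiff_const).inv fun t => sub_ne_zero.2 fun ht => hq ⟨t, ht⟩)

theorem exists_hasImproperIntegral_windingKernel (h : IsProperCurve w) (hp : p ∉ range w)
    (hq : q ∉ range w) :
    ∃ z, HasImproperIntegral (windingKernel w p q) z ∧ Complex.exp z = 1 := by
  have hlim := tendsto_sub_div_sub_cobounded p q
  rw [h.windingKernel_eq_logDeriv hp hq]
  simpa using exists_hasImproperIntegral_logDeriv (h.contDiff_sub_div_sub hq)
    (fun t => div_ne_zero (sub_ne_zero.2 fun ht => hp ⟨t, ht⟩) (sub_ne_zero.2 fun ht => hq ⟨t, ht⟩))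
    Complex.one_mem_slitPlane Complex.one_mem_slitPlane (hlim.comp h.tendsto_atBot)
    (hlim.comp h.tendsto_atTop)

theorem hasImproperIntegral_windingKernel_of_ball_subset (h : IsProperCurve w) {r : ℝ}
    (hr : Metric.ball q r ⊆ (range w)ᶜ) (hp : p ∈ Metric.ball q r) :
    HasImproperIntegral (windingKernel w p q) 0 := by
  have hq : q ∉ range w := hr (Metric.mem_ball_self (Metric.pos_of_mem_ball hp))
  have hslit : ∀ t, (w t - p) / (w t - q) ∈ Complex.slitPlane := by
    intro t
    have hwq : w t - q ≠ 0 := sub_ne_zero.2 fun ht => hq ⟨t, ht⟩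
    have hrt : r ≤ dist (w t) q := not_lt.1 fun hlt => hr (Metric.mem_ball.2 hlt) ⟨t, rfl⟩
    have hsplit : (w t - p) / (w t - q) = 1 + (q - p) / (w t - q) := by
      field_simp
      ring
    rw [hsplit]
    refine Complex.mem_slitPlane_of_norm_lt_one ?_
    rw [norm_div, div_lt_one (norm_pos_iff.2 hwq), ← dist_eq_norm, ← dist_eq_norm, dist_comm]
    exact (Metric.mem_ball.1 hp).trans_le hrt
  have hlim := tendsto_sub_div_sub_cobounded p q
  rw [h.windingKernel_eq_logDeriv (hr hp) hq]
  simpa using hasImproperIntegral_logDeriv_of_mem_slitPlane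
    ((h.contDiff_sub_div_sub hq).differentiable one_ne_zero) hslit Complex.one_mem_slitPlane
    Complex.one_mem_slitPlane (hlim.comp h.tendsto_atBot) (hlim.comp h.tendsto_atTop)

theorem hasImproperIntegral_windingKernel_of_mem_component (h : IsProperCurve w)
    (hp : p ∈ connectedComponentIn (range w)ᶜ q) : HasImproperIntegral (windingKernel w p q) 0 := by
  have hq : q ∈ (range w)ᶜ := connectedComponentIn_nonempty_iff.1 ⟨p, hp⟩
  refine isPreconnected_connectedComponentIn.induction₂'
    (fun x y => HasImproperIntegral (windingKernel w x y) 0) (fun x hx => ?_)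
    (fun x y z _ _ _ hxy hyz => ?_) hp (mem_connectedComponentIn hq)
  · obtain ⟨r, hr, hball⟩ := Metric.isOpen_iff.1 h.isClosed_range.isOpen_compl x
      (connectedComponentIn_subset _ _ hx)
    filter_upwards [nhdsWithin_le_nhds (Metric.ball_mem_nhds x hr)] with y hy
    have hyx := h.hasImproperIntegral_windingKernel_of_ball_subset hball hy
    exact ⟨by simpa only [neg_windingKernel, neg_zero] using hyx.neg, hyx⟩
  · simpa only [windingKernel_add_windingKernel, add_zero] using hxy.add hyz

end IsProperCurve

end Winding

section PartialFractions

variable {F ι : Type*} [Field F] [DecidableEq ι] {s : Finset ι} {v : ι → F}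

theorem sum_nodalWeight_eq_zero (hv : InjOn v s) (hs : 1 < s.card) :
    ∑ i ∈ s, Lagrange.nodalWeight s v i = 0 := by
  have hdeg : (1 : F[X]).degree < s.card := by
    rw [degree_one]
    exact_mod_cast zero_lt_one.trans hs
  have hcoeff := Lagrange.coeff_eq_sum hv hdeg
  rw [coeff_one, if_neg (Nat.sub_ne_zero_of_lt hs)] at hcoeff
  simpa only [Lagrange.nodalWeight, Finset.prod_inv_distrib, eval_one, one_div] using hcoeff.symm

theorem eval_nodal_mul_sum_nodalWeight_mul_inv (hv : InjOn v s) (hs : s.Nonempty) {x : F}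
    (hx : ∀ i ∈ s, x ≠ v i) :
    (Lagrange.nodal s v).eval x * ∑ i ∈ s, Lagrange.nodalWeight s v i * (x - v i)⁻¹ = 1 := by
  simpa [Lagrange.interpolate_one hv hs] using
    (Lagrange.eval_interpolate_not_at_node (1 : ι → F) hx).symm

end PartialFractions

section Residues

variable {d : ℕ} {e : Fin d → ℂ}

theorem poly_eq_nodal (e : Fin d → ℂ) : poly e = Lagrange.nodal Finset.univ e :=
  (Lagrange.nodal_eq _ _).symm

theorem eta_eq_nodalWeight (e : Fin d → ℂ) (j : Fin d) :
    eta e j = Lagrange.nodalWeight Finset.univ e j := by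
  rw [eta, poly_eq_nodal, Lagrange.nodalWeight_eq_eval_derivative_nodal (Finset.mem_univ j),
    one_div]

theorem sum_eta_mul_inv_sub_inv (he : Function.Injective e) (hd : 2 ≤ d) {x : ℂ}
    (hx : (poly e).eval x ≠ 0) (q : ℂ) :
    ∑ j, eta e j * ((x - e j)⁻¹ - (x - q)⁻¹) = ((poly e).eval x)⁻¹ := by
  have hx' : ∀ j ∈ Finset.univ, x ≠ e j := by
    rintro j - rfl
    exact hx (by rw [poly_eq_nodal, Lagrange.eval_nodal_at_node (Finset.mem_univ j)])
  have hcard : 1 < (Finset.univ : Finset (Fin d)).card := by rwa [Finset.card_fin]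
  rw [poly_eq_nodal]
  simp only [eta_eq_nodalWeight, mul_sub, Finset.sum_sub_distrib, ← Finset.sum_mul,
    sum_nodalWeight_eq_zero he.injOn hcard, zero_mul, sub_zero]
  exact eq_inv_of_mul_eq_one_right (eval_nodal_mul_sum_nodalWeight_mul_inv he.injOn
    (Finset.card_pos.1 (zero_lt_one.trans hcard)) hx')

namespace IsProperTrajectory

variable {ρ : ℝ → ℝ} {w : ℝ → ℂ}

theorem notMem_range (h : IsProperTrajectory (fun x => (poly e).eval x) ρ w) (j : Fin d) :
    e j ∉ range w := by
  rintro ⟨t, ht⟩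
  refine h.ne_zero t ?_
  simp only [ht, poly_eq_nodal, Lagrange.eval_nodal_at_node (Finset.mem_univ j)]

theorem sum_eta_mul_windingKernel (h : IsProperTrajectory (fun x => (poly e).eval x) ρ w)
    (he : Function.Injective e) (hd : 2 ≤ d) (q : ℂ) (t : ℝ) :
    ∑ j, eta e j * windingKernel w (e j) q t = ρ t := by
  simp only [windingKernel, (h.hasDerivAt t).deriv, mul_left_comm (eta e _), ← Finset.mul_sum]
  rw [sum_eta_mul_inv_sub_inv he hd (h.ne_zero t), mul_assoc, mul_inv_cancel₀ (h.ne_zero t),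
    mul_one]

theorem exists_pos_sum_eta_mul_eq (h : IsProperTrajectory (fun x => (poly e).eval x) ρ w)
    (he : Function.Injective e) (hd : 2 ≤ d) {q : ℂ} {J : Finset (Fin d)} {z : ℂ}
    (hJ : ∀ j ∈ J, HasImproperIntegral (windingKernel w (e j) q) z)
    (hJ' : ∀ j ∉ J, HasImproperIntegral (windingKernel w (e j) q) 0) :
    ∃ T : ℝ, 0 < T ∧ (∑ j ∈ J, eta e j) * z = T := by
  have hz : ∀ j, HasImproperIntegral (windingKernel w (e j) q) (if j ∈ J then z else 0) := by
    intro j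
    split_ifs with hj
    exacts [hJ j hj, hJ' j hj]
  have hsum := HasImproperIntegral.sum fun j (_ : j ∈ Finset.univ) => (hz j).const_mul (eta e j)
  simp only [h.sum_eta_mul_windingKernel he hd, mul_ite, mul_zero, Finset.sum_ite_mem,
    Finset.univ_inter, ← Finset.sum_mul] at hsum
  exact hsum.exists_pos_of_ofReal h.rate_pos

theorem exists_common_integral_windingKernel
    (h : IsProperTrajectory (fun x => (poly e).eval x) ρ w) {i : Fin d} {J : Finset (Fin d)}
    (hJ : ∀ j ∈ J, e j ∉ connectedComponentIn (range w)ᶜ (e i)) :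
    ∃ x : ℝ, ∀ j ∈ J, HasImproperIntegral (windingKernel w (e j) (e i)) (x * Complex.I) := by
  rcases J.eq_empty_or_nonempty with rfl | ⟨k, hk⟩
  · exact ⟨0, by simp⟩
  obtain ⟨z, hz, hexp⟩ :=
    h.exists_hasImproperIntegral_windingKernel (h.notMem_range k) (h.notMem_range i)
  obtain ⟨n, hn⟩ := Complex.exp_eq_one_iff.1 hexp
  refine ⟨n * (2 * Real.pi), fun j hj => ?_⟩
  have hjk : e j ∈ connectedComponentIn (range w)ᶜ (e k) :=
    h.mem_component_of_notMem_component (poly e).differentiable (h.notMem_range i)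
      (h.notMem_range k) (h.notMem_range j) (hJ k hk) (hJ j hj)
  have hz' : z = (n * (2 * Real.pi) : ℝ) * Complex.I := by
    rw [hn]
    push_cast
    ring
  simpa only [windingKernel_add_windingKernel, zero_add, hz'] using
    (h.hasImproperIntegral_windingKernel_of_mem_component hjk).add hz

theorem nonempty_and_sum_eta_re_eq_zero
    (h : IsProperTrajectory (fun x => (poly e).eval x) ρ w) (he : Function.Injective e)
    (hd : 2 ≤ d) {i : Fin d} {J : Finset (Fin d)}
    (hJ : ∀ j, j ∈ J ↔ e j ∉ connectedComponentIn (range w)ᶜ (e i)) :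
    J.Nonempty ∧ ∑ j ∈ J, (eta e j).re = 0 := by
  obtain ⟨x, hx⟩ := h.exists_common_integral_windingKernel fun j => (hJ j).1
  obtain ⟨T, hT, hsum⟩ := h.exists_pos_sum_eta_mul_eq he hd hx fun j hj =>
    h.hasImproperIntegral_windingKernel_of_mem_component (not_not.1 (mt (hJ j).2 hj))
  have hne : (∑ j ∈ J, eta e j) * (x * Complex.I) ≠ 0 :=
    hsum ▸ Complex.ofReal_ne_zero.2 hT.ne'
  refine ⟨Finset.nonempty_of_sum_ne_zero (left_ne_zero_of_mul hne), ?_⟩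
  have hx0 : x ≠ 0 := by
    rintro rfl
    simp at hne
  have him : (∑ j ∈ J, eta e j).re * x = 0 := by
    simpa [-Complex.re_sum, -mul_eq_zero] using congrArg Complex.im hsum
  rw [← Complex.re_sum]
  exact (mul_eq_zero.1 him).resolve_right hx0

end IsProperTrajectory

end Residues

section IntegralCurves

theorem eq_of_periodic_of_tendsto_atTop {X : Type*} [TopologicalSpace X] [T2Space X] {γ : ℝ → X}
    {B : X} {T : ℝ} (hT : 0 < T) (hper : Function.Periodic γ T) (hlim : Tendsto γ atTop (𝓝 B))
    (t : ℝ) : γ t = B := by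
  have hshift : Tendsto (fun n : ℕ => t + n * T) atTop atTop :=
    tendsto_atTop_add_const_left _ _ (tendsto_natCast_atTop_atTop.atTop_mul_const hT)
  exact tendsto_nhds_unique (tendsto_const_nhds.congr fun n => (hper.nat_mul n t).symm)
    (hlim.comp hshift)

open scoped Manifold

variable {E : Type*} [NormedAddCommGroup E] [NormedSpace ℝ E] {v : E → E} {γ : ℝ → E}

theorem isMIntegralCurve_of_hasDerivAt (h : ∀ t, HasDerivAt γ (v (γ t)) t) :
    IsMIntegralCurve (I := 𝓘(ℝ, E)) γ v := fun t =>
  (h t).hasFDerivAt.hasMFDerivAt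

theorem integralCurve_injective_of_tendsto (hv : ContDiff ℝ 1 v)
    (h : ∀ t, HasDerivAt γ (v (γ t)) t) {B : E} (hlim : Tendsto γ atTop (𝓝 B))
    (hB : ∃ t, γ t ≠ B) : Function.Injective γ := by
  rcases (isMIntegralCurve_of_hasDerivAt h).periodic_xor_injective
    (contMDiff_vectorSpace_iff_contDiff.2 hv) with ⟨⟨T, hT, hper⟩, -⟩ | ⟨hinj, -⟩
  · obtain ⟨t, ht⟩ := hB
    exact absurd (eq_of_periodic_of_tendsto_atTop hT hper hlim t) ht
  · exact hinj

theorem integralCurve_ne_zero_of_injective (hv : ContDiff ℝ 1 v)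
    (h : ∀ t, HasDerivAt γ (v (γ t)) t) (hinj : Function.Injective γ) (t : ℝ) : v (γ t) ≠ 0 := by
  intro h0
  have hconst : γ = fun _ => γ t :=
    isMIntegralCurve_Ioo_eq_of_contMDiff_boundaryless (t₀ := t)
      (contMDiff_vectorSpace_iff_contDiff.2 hv) (isMIntegralCurve_of_hasDerivAt h)
      (isMIntegralCurve_const h0) rfl
  exact (lt_add_one t).ne' (hinj (congrFun hconst (t + 1)))

end IntegralCurves

section CentralProjection

/-- The inverse `w = x / s` of the central projection `toDisk`, i.e. the affine chart of the open
disk. -/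
noncomputable def ofDisk (p : ℂ × ℝ) : ℂ := p.1 / p.2

theorem sqrt_one_add_norm_sq_pos (w : ℂ) : 0 < √(1 + ‖w‖ ^ 2) :=
  Real.sqrt_pos.2 (by positivity)

theorem leftInverse_ofDisk_toDisk : Function.LeftInverse ofDisk toDisk := by
  intro w
  have hne : (√(1 + ‖w‖ ^ 2) : ℂ) ≠ 0 := by exact_mod_cast (sqrt_one_add_norm_sq_pos w).ne'
  simp only [ofDisk, toDisk]
  push_cast
  field_simp

theorem toDisk_mem_openDisk (w : ℂ) : toDisk w ∈ openDisk := by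
  have hpos := sqrt_one_add_norm_sq_pos w
  have hs : 0 < (toDisk w).2 := one_div_pos.2 hpos
  refine ⟨⟨?_, hs.le⟩, hs⟩
  simp only [toDisk, norm_div, Complex.norm_real, Real.norm_of_nonneg hpos.le, div_pow,
    Real.sq_sqrt (show 0 ≤ 1 + ‖w‖ ^ 2 by positivity)]
  field_simp
  ring

theorem leftInvOn_toDisk_ofDisk : LeftInvOn toDisk ofDisk openDisk := by
  rintro ⟨x, s⟩ ⟨⟨hsphere, -⟩, hs⟩
  have hsC : (s : ℂ) ≠ 0 := by exact_mod_cast hs.ne'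
  have hsq : 1 + ‖x / (s : ℂ)‖ ^ 2 = (1 / s) ^ 2 := by
    rw [norm_div, Complex.norm_real, Real.norm_of_nonneg hs.le]
    field_simp
    linarith
  have hsqrt : √(1 + ‖x / (s : ℂ)‖ ^ 2) = 1 / s := by
    rw [hsq, Real.sqrt_sq (one_div_pos.2 hs).le]
  simp only [toDisk, ofDisk, hsqrt, one_div_one_div, Complex.ofReal_div, Complex.ofReal_one]
  field_simp

theorem continuous_toDisk : Continuous toDisk := by
  have hsqrt : Continuous fun w : ℂ => √(1 + ‖w‖ ^ 2) := by fun_prop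
  exact (continuous_id.div (Complex.continuous_ofReal.comp hsqrt) fun w =>
    Complex.ofReal_ne_zero.2 (sqrt_one_add_norm_sq_pos w).ne').prodMk
    (continuous_const.div hsqrt fun w => (sqrt_one_add_norm_sq_pos w).ne')

theorem continuousOn_ofDisk : ContinuousOn ofDisk openDisk :=
  continuous_fst.continuousOn.div (Complex.continuous_ofReal.comp continuous_snd).continuousOn
    fun _ hp => Complex.ofReal_ne_zero.2 hp.2.ne'

theorem image_toDisk_compl_range_ofDisk_comp {T : Type*} {γ : T → ℂ × ℝ}
    (hγ : ∀ t, γ t ∈ openDisk) : toDisk '' (range (ofDisk ∘ γ))ᶜ = openDisk \ range γ := by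
  have hdisk : range toDisk = openDisk := by
    refine Subset.antisymm (range_subset_iff.2 toDisk_mem_openDisk) fun p hp => ?_
    exact ⟨ofDisk p, leftInvOn_toDisk_ofDisk hp⟩
  have hrange : toDisk ∘ ofDisk ∘ γ = γ := funext fun t => leftInvOn_toDisk_ofDisk (hγ t)
  rw [image_compl_eq_range_sdiff_image leftInverse_ofDisk_toDisk.injective, hdisk, ← range_comp,
    hrange]

theorem mem_oppositeSide_iff {d : ℕ} {e : Fin d → ℂ} {γ : ℝ → ℂ × ℝ}
    (hγ : ∀ t, γ t ∈ openDisk) {i j : Fin d} :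
    j ∈ oppositeSide e γ i ↔ e j ∉ connectedComponentIn (range (ofDisk ∘ γ))ᶜ (e i) := by
  have himage := image_toDisk_compl_range_ofDisk_comp hγ
  have hcont : ContinuousOn ofDisk (toDisk '' (range (ofDisk ∘ γ))ᶜ) :=
    continuousOn_ofDisk.mono (himage ▸ sdiff_subset)
  rw [← mem_connectedComponentIn_image_iff continuous_toDisk.continuousOn hcont
    leftInverse_ofDisk_toDisk, himage]
  simp only [oppositeSide, Finset.mem_filter_univ]

theorem tendsto_ofDisk_cobounded {C : ℂ × ℝ} (hC : C ∈ boundaryCircle) :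
    Tendsto ofDisk (𝓝[openDisk] C) (cobounded ℂ) := by
  obtain ⟨⟨hsphere, -⟩, hs⟩ := hC
  have hlim : 0 < ‖C.1‖ := norm_pos_iff.2 fun h => by simp [h, hs] at hsphere
  have hx : Tendsto (fun p : ℂ × ℝ => ‖p.1‖) (𝓝[openDisk] C) (𝓝 ‖C.1‖) :=
    continuous_fst.norm.continuousWithinAt
  have hsnd : Tendsto Prod.snd (𝓝[openDisk] C) (𝓝[>] 0) :=
    tendsto_nhdsWithin_iff.2 ⟨hs ▸ continuous_snd.continuousWithinAt,
      eventually_mem_nhdsWithin.mono fun p hp => hp.2⟩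
  rw [← tendsto_norm_atTop_iff_cobounded]
  refine (hx.pos_mul_atTop hlim (tendsto_inv_nhdsGT_zero.comp hsnd)).congr' ?_
  filter_upwards [eventually_mem_nhdsWithin] with p hp
  rw [ofDisk, norm_div, Complex.norm_real, Real.norm_of_nonneg hp.2.le, div_eq_mul_inv,
    Function.comp_apply]

end CentralProjection

section CompactifiedFlow

variable {d : ℕ} {e : Fin d → ℂ}

theorem contDiff_compactField (e : Fin d → ℂ) {n : WithTop ℕ∞} :
    ContDiff ℝ n (compactField e) := by
  have hs : ContDiff ℝ n fun p : ℂ × ℝ => (p.2 : ℂ) := Complex.ofRealCLM.contDiff.comp contDiff_snd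
  have hF : ContDiff ℝ n (homog e) :=
    contDiff_prod fun j _ => contDiff_fst.sub (contDiff_const.mul hs)
  have hr : ContDiff ℝ n fun p : ℂ × ℝ => ((starRingEnd ℂ) p.1 * homog e p).re :=
    Complex.reCLM.contDiff.comp ((Complex.conjCLE.contDiff.comp contDiff_fst).mul hF)
  exact (hF.sub ((Complex.ofRealCLM.contDiff.comp hr).mul contDiff_fst)).prodMk
    (contDiff_snd.mul hr).neg

theorem compactField_eq_zero_of_eval_eq_zero {p : ℂ × ℝ} (hp : p.2 ≠ 0)
    (h : (poly e).eval (ofDisk p) = 0) : compactField e p = 0 := by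
  have hs : (p.2 : ℂ) ≠ 0 := Complex.ofReal_ne_zero.2 hp
  rw [poly_eq_nodal, Lagrange.eval_nodal, Finset.prod_eq_zero_iff] at h
  obtain ⟨j, hj, h0⟩ := h
  have hfactor : p.1 - e j * p.2 = 0 := by
    rw [sub_eq_zero, ← div_eq_iff hs]
    exact sub_eq_zero.1 h0
  have hF : homog e p = 0 := Finset.prod_eq_zero hj hfactor
  simp [compactField, hF]

theorem hasDerivAt_ofDisk_comp (hd : 1 ≤ d) {γ : ℝ → ℂ × ℝ} {t : ℝ}
    (h : HasDerivAt γ (compactField e (γ t)) t) (hpos : 0 < (γ t).2) :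
    HasDerivAt (ofDisk ∘ γ)
      (((γ t).2 ^ (d - 1) : ℝ) * (poly e).eval (ofDisk (γ t))) t := by
  have hne : ((γ t).2 : ℂ) ≠ 0 := Complex.ofReal_ne_zero.2 hpos.ne'
  have hfst : HasDerivAt (fun t => (γ t).1) (compactField e (γ t)).1 t :=
    (ContinuousLinearMap.fst ℝ ℂ ℝ).hasFDerivAt.comp_hasDerivAt t h
  have hsnd : HasDerivAt (fun t => (γ t).2) (compactField e (γ t)).2 t :=
    (ContinuousLinearMap.snd ℝ ℂ ℝ).hasFDerivAt.comp_hasDerivAt t h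
  refine (hfst.div hsnd.ofReal_comp hne).congr_deriv ?_
  rw [velocity_eq e hd _ hpos, Complex.ofReal_pow, ofDisk]

namespace IsInteriorSaddleConnection

variable {A B : ℂ × ℝ} {γ : ℝ → ℂ × ℝ}

theorem snd_pos (hγ : IsInteriorSaddleConnection e A B γ) (t : ℝ) : 0 < (γ t).2 :=
  (hγ.mem_openDisk t).2

theorem continuous (hγ : IsInteriorSaddleConnection e A B γ) : Continuous γ :=
  continuous_iff_continuousAt.2 fun t => (hγ.orbit t).continuousAt

theorem ne_target (hγ : IsInteriorSaddleConnection e A B γ) (t : ℝ) : γ t ≠ B := fun h =>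
  (hγ.snd_pos t).ne' (h ▸ hγ.target_mem.1.2)

theorem injective (hγ : IsInteriorSaddleConnection e A B γ) : Function.Injective γ :=
  integralCurve_injective_of_tendsto (contDiff_compactField e) hγ.orbit hγ.tendsto_target
    ⟨0, hγ.ne_target 0⟩

theorem compactField_ne_zero (hγ : IsInteriorSaddleConnection e A B γ) (t : ℝ) :
    compactField e (γ t) ≠ 0 :=
  integralCurve_ne_zero_of_injective (contDiff_compactField e) hγ.orbit hγ.injective t

theorem isProperCurve (hγ : IsInteriorSaddleConnection e A B γ) (hd : 1 ≤ d) :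
    IsProperCurve (ofDisk ∘ γ) where
  contDiff := by
    have hderiv t := hasDerivAt_ofDisk_comp hd (hγ.orbit t) (hγ.snd_pos t)
    have hw : Continuous (ofDisk ∘ γ) := continuousOn_ofDisk.comp_continuous hγ.continuous
      hγ.mem_openDisk
    refine contDiff_one_iff_deriv.2 ⟨fun t => (hderiv t).differentiableAt, ?_⟩
    rw [funext fun t => (hderiv t).deriv]
    exact (Complex.continuous_ofReal.comp (hγ.continuous.snd.pow _)).mul
      ((poly e).continuous.comp hw)
  tendsto_atBot := (tendsto_ofDisk_cobounded hγ.source_mem.1).comp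
    (tendsto_nhdsWithin_iff.2 ⟨hγ.tendsto_source, .of_forall hγ.mem_openDisk⟩)
  tendsto_atTop := (tendsto_ofDisk_cobounded hγ.target_mem.1).comp
    (tendsto_nhdsWithin_iff.2 ⟨hγ.tendsto_target, .of_forall hγ.mem_openDisk⟩)

theorem isProperTrajectory (hγ : IsInteriorSaddleConnection e A B γ) (hd : 1 ≤ d) :
    IsProperTrajectory (fun x => (poly e).eval x) (fun t => (γ t).2 ^ (d - 1))
      (ofDisk ∘ γ) where
  toIsProperCurve := hγ.isProperCurve hd
  rate_pos t := pow_pos (hγ.snd_pos t) _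
  hasDerivAt t := hasDerivAt_ofDisk_comp hd (hγ.orbit t) (hγ.snd_pos t)
  ne_zero t h := hγ.compactField_ne_zero t <|
    compactField_eq_zero_of_eval_eq_zero (hγ.snd_pos t).ne' h
  injective a b hab := hγ.injective <|
    leftInvOn_toDisk_ofDisk.injOn (hγ.mem_openDisk a) (hγ.mem_openDisk b) hab

end IsInteriorSaddleConnection

end CompactifiedFlow

end PoincareCompactification

theorem mainTheorem10 (d : ℕ) (hd : 2 ≤ d) (e : Fin d → ℂ) (he : Function.Injective e)
    (A B : ℂ × ℝ) (γ : ℝ → ℂ × ℝ)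
    (hγ : PoincareCompactification.IsInteriorSaddleConnection e A B γ) :
    (PoincareCompactification.oppositeSide e γ ⟨0, by omega⟩).Nonempty ∧
      ∑ j ∈ PoincareCompactification.oppositeSide e γ ⟨0, by omega⟩,
        (PoincareCompactification.eta e j).re = 0 :=
  (hγ.isProperTrajectory (by omega)).nonempty_and_sum_eta_re_eq_zero he hd fun _ =>
    PoincareCompactification.mem_oppositeSide_iff hγ.mem_openDisk
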